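/- **Theorem (Oracle inequality for model comparison).** There is a universal constant $C>0$ such that the following holds. Let $\mathcal Z$ and $\mathcal F$ be spaces of samples and models, and let $\ell:\mathcal F\times\mathcal Z\to[a,b]$ be a loss function. Let $f_1,f_2\in\mathcal F$, let $t\ge 1$ be an integer, let $\mathcal P_1,\dots,\mathcal P_t$ be probability distributions on $\mathcal Z$, let $B_1,\dots,B_t\ge 1$ be integers, and let $z_{j,i}\sim\mathcal P_j$ ($1\le j\le t$, $1\le i\le B_j$) be independent samples. Write $$L_j(f)=\mathbb E_{z\sim\mathcal P_j}\,\ell(f,z),\qquad \Delta_j=L_j(f_1)-L_j(f_2),\qquad B_{t,k}=\sum_{j=t-k+1}^tB_j ,$$ $$\widetilde\sigma_{t,k}^2=\frac1{B_{t,k}}\sum_{j=t-k+1}^tB_j\,\mathrm{Var}_{z\sim\mathcal P_j}\bigl[\ell(f_1,z)-\ell(f_2,z)\bigr].$$ Put $u_{j,i}=\ell(f_1,z_{j,i})-\ell(f_2,z_{j,i})$, which lies in the interval $[a-b,\,b-a]$ of length $M=2(b-a)$. For $1\le k\le t$ let $$\widehat\Delta_{t,k}=\frac1{B_{t,k}}\sum_{j=t-k+1}^t\sum_{i=1}^{B_j}u_{j,i},$$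 let $\widehat v_{t,k}\ge 0$ be given, when $B_{t,k}\ge2$, by $$\widehat v_{t,k}^2=\frac1{B_{t,k}-1}\sum_{j=t-k+1}^t\sum_{i=1}^{B_j}\bigl(u_{j,i}-\widehat\Delta_{t,k}\bigr)^2 ,$$ and, for $\delta'\in(0,1)$, let $$\widehat\psi(t,k,\delta')=\begin{cases}M,&B_{t,k}=1,\\[2pt] \widehat v_{t,k}\sqrt{\dfrac{2\log(2/\delta')}{B_{t,k}}}+\dfrac{8M\log(2/\delta')}{3(B_{t,k}-1)},&B_{t,k}\ge2,\end{cases}$$ $$\widehat\phi(t,k,\delta')=\max_{1\le i\le k}\Bigl(|\widehat\Delta_{t,k}-\widehat\Delta_{t,i}|-\bigl[\widehat\psi(t,k,\delta')+\widehat\psi(t,i,\delta')\bigr]\Bigr)_+ .$$ The adaptive rolling window comparison chooses any $\widehat k\in\operatorname{argmin}_{1\le k\le t}\{\widehat\phi(t,k,\delta')+\widehat\psi(t,k,\delta')\}$ and outputs $\widehat f=f_1$ if $\widehat\Delta_{t,\widehat k}\le0$ and $\widehat f=f_2$ if $\widehat\Delta_{t,\widehat k}>0$. Let $\delta\in(0,1)$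 and take $\delta'=\delta/(3t)$. Then, with probability at least $1-\delta$, every possible output $\widehat f$ (that is, for every choice of the minimizer $\widehat k$) satisfies $$L_t(\widehat f)-\min_{r\in\{1,2\}}L_t(f_r)\;\le\; C\,\max\{1,b-a\}\,\log\frac{6t}{\delta}\;\min_{1\le k\le t}\left\{\max_{t-k+1\le j\le t}|\Delta_j-\Delta_t|+\frac{\widetilde\sigma_{t,k}}{\sqrt{B_{t,k}}}+\frac1{B_{t,k}}\right\}.$$ -/

import Mathlib

open MeasureTheory ProbabilityTheory

noncomputable section

namespace RollingWindow

/-- The look-back window `{t - k + 1, …, t}` of the `k` most recent periods (used for `1 ≤ k ≤ t`;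
periods are numbered `1, 2, …`). -/
def window (t k : ℕ) : Finset ℕ := Finset.Icc (t - k + 1) t

/-- `B_{t,k}`, the number of samples in the window. -/
def windowSize (B : ℕ → ℕ) (t k : ℕ) : ℕ := ∑ j ∈ window t k, B j

section MeanEstimation

variable {B : ℕ → ℕ}

/-- The window average `μ̂_{t,k}` of real data `u j i`, `i < B j`. -/
def muHat (u : (j : ℕ) → Fin (B j) → ℝ) (t k : ℕ) : ℝ :=
  (windowSize B t k : ℝ)⁻¹ * ∑ j ∈ window t k, ∑ i, u j i

/-- The sample standard deviation `v̂_{t,k}` over the window (used when `B_{t,k} ≥ 2`). -/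
def vHat (u : (j : ℕ) → Fin (B j) → ℝ) (t k : ℕ) : ℝ :=
  √(1 / ((windowSize B t k : ℝ) - 1) * ∑ j ∈ window t k, ∑ i, (u j i - muHat u t k) ^ 2)

/-- The variance proxy `ψ̂(t, k, δ)`, with range hyperparameter `M`. -/
def psiHat (u : (j : ℕ) → Fin (B j) → ℝ) (M δ : ℝ) (t k : ℕ) : ℝ :=
  if windowSize B t k = 1 then M
  else vHat u t k * √(2 * Real.log (2 / δ) / (windowSize B t k : ℝ))
    + 8 * M * Real.log (2 / δ) / (3 * ((windowSize B t k : ℝ) - 1))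

/-- The bias proxy `φ̂(t, k, δ)`: a maximum of positive parts over the smaller windows. -/
def phiHat (u : (j : ℕ) → Fin (B j) → ℝ) (M δ : ℝ) (t k : ℕ) : ℝ :=
  ⨆ i : Finset.Icc 1 k,
    max (|muHat u t k - muHat u t i| - (psiHat u M δ t k + psiHat u M δ t i)) 0

/-- `k` is an admissible adaptive window: a minimizer over `{1, …, t}` of `φ̂ + ψ̂`
(ties may be broken in any way). -/
def IsSelectedWindow (u : (j : ℕ) → Fin (B j) → ℝ) (M δ : ℝ) (t k : ℕ) : Prop :=
  k ∈ Finset.Icc 1 t ∧ ∀ k' ∈ Finset.Icc 1 t,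
    phiHat u M δ t k + psiHat u M δ t k ≤ phiHat u M δ t k' + psiHat u M δ t k'

end MeanEstimation

section Comparison

variable {F Z : Type*} {B : ℕ → ℕ}

/-- The loss differences `u_{j,i} = ℓ(f₁, z_{j,i}) - ℓ(f₂, z_{j,i})`. -/
def lossDiff (ℓ : F → Z → ℝ) (f₁ f₂ : F) (z : (j : ℕ) → Fin (B j) → Z) :
    (j : ℕ) → Fin (B j) → ℝ :=
  fun j i => ℓ f₁ (z j i) - ℓ f₂ (z j i)

/-- `f` is a possible output of the adaptive rolling window comparison of `f₁` and `f₂` on the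
data `z`: for some admissible adaptive window `k` for the loss differences, `f` is `f₁` if the
window average of the loss differences is nonpositive, and `f₂` otherwise. -/
def IsCompareOutput (ℓ : F → Z → ℝ) (f₁ f₂ : F) (z : (j : ℕ) → Fin (B j) → Z) (M δ : ℝ)
    (t : ℕ) (f : F) : Prop :=
  ∃ k, IsSelectedWindow (lossDiff ℓ f₁ f₂ z) M δ t k ∧
    (muHat (lossDiff ℓ f₁ f₂ z) t k ≤ 0 ∧ f = f₁ ∨
      0 < muHat (lossDiff ℓ f₁ f₂ z) t k ∧ f = f₂)

/-- The comparison always has an output. -/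
theorem exists_isCompareOutput (ℓ : F → Z → ℝ) (f₁ f₂ : F) (z : (j : ℕ) → Fin (B j) → Z)
    (M δ : ℝ) (t : ℕ) (ht : 1 ≤ t) : ∃ f, IsCompareOutput ℓ f₁ f₂ z M δ t f := by
  obtain ⟨k, hk, hmin⟩ := Finset.exists_min_image (Finset.Icc 1 t)
    (fun k => phiHat (lossDiff ℓ f₁ f₂ z) M δ t k + psiHat (lossDiff ℓ f₁ f₂ z) M δ t k)
    (Finset.nonempty_Icc.mpr ht)
  rcases le_or_gt (muHat (lossDiff ℓ f₁ f₂ z) t k) 0 with h | h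
  · exact ⟨f₁, k, ⟨hk, hmin⟩, Or.inl ⟨h, rfl⟩⟩
  · exact ⟨f₂, k, ⟨hk, hmin⟩, Or.inr ⟨h, rfl⟩⟩

variable [MeasurableSpace Z]

/-- The risk (population loss) of `f` under the distribution `P`. -/
def risk (ℓ : F → Z → ℝ) (P : Measure Z) (f : F) : ℝ := ∫ z, ℓ f z ∂P

/-- The performance gap `Δ_j` between `f₁` and `f₂` at time `j`. -/
def gap (ℓ : F → Z → ℝ) (P : ℕ → Measure Z) (f₁ f₂ : F) (j : ℕ) : ℝ :=
  risk ℓ (P j) f₁ - risk ℓ (P j) f₂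

/-- `σ̃_{t,k}`: the square root of the average over the window of the variances of the loss
difference. -/
def sigmaTilde (ℓ : F → Z → ℝ) (P : ℕ → Measure Z) (B : ℕ → ℕ) (f₁ f₂ : F) (t k : ℕ) : ℝ :=
  √(1 / (windowSize B t k : ℝ) *
    ∑ j ∈ window t k, (B j : ℝ) * variance (fun z => ℓ f₁ z - ℓ f₂ z) (P j))

/-- The bias-variance bound of the window `k`:
`max_{t-k+1 ≤ j ≤ t} |Δ_j - Δ_t| + σ̃_{t,k} / √B_{t,k} + 1 / B_{t,k}`. -/
def oracleBound (ℓ : F → Z → ℝ) (P : ℕ → Measure Z) (B : ℕ → ℕ) (f₁ f₂ : F) (t k : ℕ) : ℝ :=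
  (⨆ j : window t k, |gap ℓ P f₁ f₂ j - gap ℓ P f₁ f₂ t|)
    + sigmaTilde ℓ P B f₁ f₂ t k / √(windowSize B t k : ℝ) + 1 / (windowSize B t k : ℝ)

end Comparison

end RollingWindow

end

/-! The output is decided by the sign of an estimate of `Δ_t`. When the wrong model is chosen, the
estimate and `Δ_t` have opposite signs, so the excess risk `|Δ_t|` is at most the estimation error.
It therefore suffices to estimate `Δ_t` adaptively.

Two ingredients carry this. The first is an empirical Bernstein inequality for independent, not
identically distributed variables (`empirical_bernstein`): off an event of probability `4 exp(-L)`,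
a window average is within `ψ̂` of its mean, and the sample variance is at most of the order of the
average second moment about the pooled mean. That moment is at most the average variance plus four
times the squared drift (`average_sq_le`), so `ψ̂` is itself of the order of the oracle bound
(`variance_proxy_le`).

The second is deterministic and of Lepski type (`abs_muHat_selected_sub_le`): when all window
averages are within `ψ̂` of their means, `φ̂` is at most twice the drift, and the minimizer of `φ̂ +
ψ̂` competes with every fixed window up to constants.

A union bound over the `t` windows with `δ' = δ/(3t)`, hence `L = log(6t/δ)`, costs at most `2δ/3`.
-/

namespace RollingWindow

/-! ### Exponential moments and tail bounds for independent sums -/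

/-- The exponential bound behind Bernstein's inequality. -/
lemma exp_le_one_add_add_sq_div {y c : ℝ} (hy : |y| ≤ c) (hc : c < 3) :
    Real.exp y ≤ 1 + (y + y ^ 2 / (2 * (1 - c / 3))) := by
  have hc0 : 0 ≤ c := (abs_nonneg y).trans hy
  have hexp : HasSum (fun k : ℕ => y ^ k / (k.factorial : ℝ)) (Real.exp y) := by
    rw [Real.exp_eq_exp_ℝ]
    exact NormedSpace.expSeries_div_hasSum_exp y
  have htail : HasSum (fun k : ℕ => y ^ (k + 2) / ((k + 2).factorial : ℝ))
      (Real.exp y - ∑ k ∈ Finset.range 2, y ^ k / (k.factorial : ℝ)) :=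
    (hasSum_nat_add_iff' 2).mpr hexp
  have hgeom : HasSum (fun k : ℕ => y ^ 2 / 2 * (c / 3) ^ k) (y ^ 2 / 2 * (1 - c / 3)⁻¹) :=
    (hasSum_geometric_of_lt_one (by positivity) (by linarith)).mul_left _
  -- Growth by a factor of at least 3 dominates the tail by a geometric series of ratio `c / 3`.
  have hfact : ∀ k : ℕ, 2 * 3 ^ k ≤ (k + 2).factorial := by
    intro k
    simpa [add_comm] using Nat.factorial_mul_pow_le_factorial (m := 2) (n := k)
  have hle : ∀ k : ℕ, y ^ (k + 2) / ((k + 2).factorial : ℝ) ≤ y ^ 2 / 2 * (c / 3) ^ k := by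
    intro k
    have h1 : y ^ (k + 2) ≤ y ^ 2 * c ^ k := by
      rw [pow_add, mul_comm]
      refine mul_le_mul_of_nonneg_left ?_ (sq_nonneg y)
      calc y ^ k ≤ |y ^ k| := le_abs_self _
        _ = |y| ^ k := abs_pow y k
        _ ≤ c ^ k := by gcongr
    calc y ^ (k + 2) / ((k + 2).factorial : ℝ) ≤ y ^ 2 * c ^ k / ((k + 2).factorial : ℝ) := by
          gcongr
      _ ≤ y ^ 2 * c ^ k / (2 * 3 ^ k) := by
          gcongr
          exact_mod_cast hfact k
      _ = y ^ 2 / 2 * (c / 3) ^ k := by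
          rw [div_pow]; field_simp
  have hsum := hasSum_le hle htail hgeom
  have heq : y ^ 2 / (2 * (1 - c / 3)) = y ^ 2 / 2 * (1 - c / 3)⁻¹ := by
    rw [div_mul_eq_div_div, div_eq_mul_inv (y ^ 2 / 2)]
  rw [heq]
  simp [Finset.sum_range_succ] at hsum
  linarith

/-- Follows from `1 + y + y²/2 ≤ exp y` and `(1 - y + y²/2)(1 + y + y²/2) = 1 + y⁴/4`. Having no
higher-order term, it gives a purely sub-Gaussian lower tail for nonnegative variables. -/
lemma exp_neg_le_one_sub_add_sq {y : ℝ} (hy : 0 ≤ y) :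
    Real.exp (-y) ≤ 1 + (-y + y ^ 2 / 2) := by
  have h := Real.quadratic_le_exp_of_nonneg hy
  rw [Real.exp_neg, inv_le_iff_one_le_mul₀ (Real.exp_pos y)]
  have hq : 0 ≤ 1 + (-y + y ^ 2 / 2) := by nlinarith [sq_nonneg (y - 1)]
  calc (1 : ℝ) ≤ (1 + (-y + y ^ 2 / 2)) * (1 + y + y ^ 2 / 2) := by nlinarith [sq_nonneg (y ^ 2)]
    _ ≤ _ := by gcongr

lemma exp_le_one_add_two_mul {y : ℝ} (hy : 0 ≤ y) (hy1 : y ≤ 1) :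
    Real.exp y ≤ 1 + 2 * y := by
  have h := exp_le_one_add_add_sq_div (y := y) (c := 1) (by rwa [abs_of_nonneg hy]) (by norm_num)
  have h2 : y ^ 2 / (2 * (1 - 1 / 3)) = 3 / 4 * y ^ 2 := by ring
  rw [h2] at h
  nlinarith

variable {Ω ι : Type*} [MeasurableSpace Ω] {μ : Measure Ω} [Fintype ι]

/-- Chernoff's bound for a sum of independent variables whose exponentials are dominated by
`1 + G i`. -/
lemma measureReal_le_sum_le_exp {X G : ι → Ω → ℝ} (hind : iIndepFun X μ)
    (hX : ∀ i, AEMeasurable (X i) μ) {l : ℝ} (hl : 0 ≤ l) (hG : ∀ i, Integrable (G i) μ)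
    (hXG : ∀ i ω, Real.exp (l * X i ω) ≤ 1 + G i ω) (ε : ℝ) :
    μ.real {ω | ε ≤ ∑ i, X i ω} ≤ Real.exp (-l * ε + ∑ i, ∫ ω, G i ω ∂μ) := by
  have := hind.isProbabilityMeasure
  have hint : ∀ i, Integrable (fun ω => Real.exp (l * X i ω)) μ := fun i =>
    Integrable.mono' ((integrable_const 1).add (hG i))
      ((hX i).const_mul l).exp.aestronglyMeasurable
      (ae_of_all _ fun ω => by
        rw [Real.norm_eq_abs, abs_of_pos (Real.exp_pos _)]
        exact hXG i ω)
  have hmgf : ∀ i, mgf (X i) μ l ≤ Real.exp (∫ ω, G i ω ∂μ) := fun i => by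
    calc mgf (X i) μ l ≤ ∫ ω, (1 + G i ω) ∂μ :=
          integral_mono (hint i) ((integrable_const 1).add (hG i)) (hXG i)
      _ = ∫ ω, G i ω ∂μ + 1 := by
          rw [integral_add (integrable_const 1) (hG i)]; simp [add_comm]
      _ ≤ _ := Real.add_one_le_exp _
  -- A non-integrable function has integral 0 by convention, while this integral is a product of
  -- positive factors.
  have hsum : Integrable (fun ω => Real.exp (l * (∑ i, X i) ω)) μ :=
    .of_integral_ne_zero <| by
      change mgf (∑ i, X i) μ l ≠ 0
      rw [hind.mgf_sum₀ hX]
      exact Finset.prod_ne_zero_iff.mpr fun i _ => (mgf_pos (hint i)).ne'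
  have h := measure_ge_le_exp_mul_mgf ε hl hsum
  rw [hind.mgf_sum₀ hX] at h
  simp only [Finset.sum_apply] at h
  refine h.trans ?_
  rw [Real.exp_add, Real.exp_sum]
  gcongr with i
  · exact fun i _ => mgf_nonneg
  · exact hmgf i

/-- Bernstein's inequality for bounded centered independent variables. -/
lemma measureReal_bernstein_lt_sum_le {X : ι → Ω → ℝ} (hind : iIndepFun X μ)
    (hX : ∀ i, AEMeasurable (X i) μ) {M V L : ℝ} (hM : ∀ i ω, |X i ω| ≤ M)
    (hmean : ∀ i, ∫ ω, X i ω ∂μ = 0) (hV : ∑ i, ∫ ω, X i ω ^ 2 ∂μ ≤ V) (hM0 : 0 ≤ M)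
    (hL : 0 < L) :
    μ.real {ω | √(2 * V * L) + M * L / 3 < ∑ i, X i ω} ≤ Real.exp (-L) := by
  have := hind.isProbabilityMeasure
  have hint : ∀ i, Integrable (X i) μ := fun i =>
    Integrable.of_bound (hX i).aestronglyMeasurable M (ae_of_all _ (hM i))
  have hint2 : ∀ i, Integrable (fun ω => X i ω ^ 2) μ := fun i =>
    Integrable.of_bound ((hX i).pow_const 2).aestronglyMeasurable (M ^ 2) (ae_of_all _ fun ω => by
      rw [norm_pow]; exact pow_le_pow_left₀ (norm_nonneg _) (hM i ω) 2)
  have hnn : ∀ i, 0 ≤ ∫ ω, X i ω ^ 2 ∂μ := fun i => integral_nonneg fun ω => sq_nonneg _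
  have hV0 : 0 ≤ V := (Finset.sum_nonneg fun i _ => hnn i).trans hV
  rcases hV0.eq_or_lt with rfl | hVpos
  · have hz : ∀ i, ∀ᵐ ω ∂μ, X i ω = 0 := by
      intro i
      have h0 : ∫ ω, X i ω ^ 2 ∂μ = 0 :=
        le_antisymm ((Finset.single_le_sum (fun i _ => hnn i) (Finset.mem_univ i)).trans hV)
          (hnn i)
      rw [integral_eq_zero_iff_of_nonneg (fun ω => sq_nonneg _) (hint2 i)] at h0
      filter_upwards [h0] with ω hω
      simpa using hω
    have : μ.real {ω | √(2 * 0 * L) + M * L / 3 < ∑ i, X i ω} = 0 := by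
      rw [measureReal_eq_zero_iff]
      have : ∀ᵐ ω ∂μ, ¬ (√(2 * 0 * L) + M * L / 3 < ∑ i, X i ω) := by
        filter_upwards [ae_all_iff.mpr hz] with ω hω
        simp only [hω, Finset.sum_const_zero, not_lt]
        positivity
      simpa [ae_iff] using this
    rw [this]
    positivity
  -- The Chernoff parameter is `w / D`, chosen so that `1 - (w / D) M / 3 = 1 / D`; the exponent
  -- then equals `-L` exactly. Dividing by `V` is why `V = 0` was treated apart.
  · set w := √(2 * L / V) with hw
    have hwpos : 0 < w := Real.sqrt_pos.mpr (by positivity)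
    have hw2 : V * w ^ 2 = 2 * L := by
      rw [hw, Real.sq_sqrt (by positivity)]; field_simp
    have hwV : √(2 * V * L) = V * w := by
      rw [Real.sqrt_eq_iff_mul_self_eq (by positivity) (by positivity)]
      linear_combination (-V) * hw2
    set D := 1 + w * M / 3 with hD
    have hDpos : 0 < D := by positivity
    have hlM : w / D * M < 3 := by
      rw [div_mul_eq_mul_div, div_lt_iff₀ hDpos, hD]; linarith
    have hone : 1 - w / D * M / 3 = 1 / D := by
      field_simp
      rw [hD]; ring
    have h := measureReal_le_sum_le_exp hind hX (l := w / D) (by positivity)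
      (G := fun i ω => w / D * X i ω + w ^ 2 / (2 * D) * X i ω ^ 2)
      (fun i => ((hint i).const_mul _).add ((hint2 i).const_mul _))
      (fun i ω => by
        have := exp_le_one_add_add_sq_div (y := w / D * X i ω) (c := w / D * M) (by
          rw [abs_mul, abs_of_nonneg (by positivity : 0 ≤ w / D)]
          exact mul_le_mul_of_nonneg_left (hM i ω) (by positivity)) hlM
        rw [hone] at this
        refine this.trans_eq ?_
        field_simp) (√(2 * V * L) + M * L / 3)
    refine (measureReal_mono (fun ω hω => ?_)).trans (h.trans ?_)
    · simp only [Set.mem_ofPred_eq] at hω ⊢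
      exact hω.le
    · rw [Real.exp_le_exp]
      have hG : ∑ i, ∫ ω, (w / D * X i ω + w ^ 2 / (2 * D) * X i ω ^ 2) ∂μ
          ≤ w ^ 2 / (2 * D) * V := by
        calc _ = ∑ i, w ^ 2 / (2 * D) * ∫ ω, X i ω ^ 2 ∂μ := by
              refine Finset.sum_congr rfl fun i _ => ?_
              rw [integral_add ((hint i).const_mul _) ((hint2 i).const_mul _),
                integral_const_mul, integral_const_mul, hmean i]
              simp
          _ ≤ _ := by
              rw [← Finset.mul_sum]
              gcongr
      have e1 : -(w / D) * (√(2 * V * L) + M * L / 3) + w ^ 2 / (2 * D) * V = -L := by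
        rw [hwV]
        field_simp
        rw [hD]
        linear_combination (-3) * hw2
      linarith

/-- Lower tail of a sum of nonnegative independent variables. -/
lemma measureReal_sum_lt_le {Y : ι → Ω → ℝ} (hind : iIndepFun Y μ)
    (hY : ∀ i, AEMeasurable (Y i) μ) {K W L : ℝ} (hY0 : ∀ i ω, 0 ≤ Y i ω)
    (hK : ∀ i ω, Y i ω ≤ K) (hW : K * ∑ i, ∫ ω, Y i ω ∂μ ≤ W) (hL : 0 < L) :
    μ.real {ω | ∑ i, Y i ω < ∑ i, ∫ ω, Y i ω ∂μ - √(2 * W * L)} ≤ Real.exp (-L) := by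
  have := hind.isProbabilityMeasure
  have hint : ∀ i, Integrable (Y i) μ := fun i =>
    Integrable.of_bound (hY i).aestronglyMeasurable K (ae_of_all _ fun ω => by
      rw [Real.norm_eq_abs, abs_of_nonneg (hY0 i ω)]; exact hK i ω)
  have hint2 : ∀ i, Integrable (fun ω => Y i ω ^ 2) μ := fun i =>
    Integrable.of_bound ((hY i).pow_const 2).aestronglyMeasurable (K ^ 2) (ae_of_all _ fun ω => by
      rw [norm_pow, Real.norm_eq_abs, abs_of_nonneg (hY0 i ω)]
      exact pow_le_pow_left₀ (hY0 i ω) (hK i ω) 2)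
  -- If `W ≤ 0`, the expectations sum to at most 0, and a nonnegative sum cannot fall below that.
  rcases le_or_gt W 0 with hW0 | hWpos
  · have hempty : ∑ i, ∫ ω, Y i ω ∂μ ≤ 0 ∨ IsEmpty ι := by
      by_contra! hcon
      obtain ⟨hpos, ⟨i⟩⟩ := hcon
      obtain ⟨ω⟩ : Nonempty Ω := nonempty_of_isProbabilityMeasure μ
      have hK0 : 0 ≤ K := (hY0 i ω).trans (hK i ω)
      have hKz : K = 0 := by
        by_contra hne
        have : 0 < K * ∑ i, ∫ ω, Y i ω ∂μ := mul_pos (lt_of_le_of_ne hK0 (Ne.symm hne)) hpos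
        linarith
      have : ∑ i, ∫ ω, Y i ω ∂μ ≤ 0 := Finset.sum_nonpos fun i _ =>
        integral_nonpos fun ω => (hK i ω).trans hKz.le
      linarith
    have hsum : ∑ i, ∫ ω, Y i ω ∂μ ≤ 0 := by
      rcases hempty with h | h
      · exact h
      · simp
    have : {ω | ∑ i, Y i ω < ∑ i, ∫ ω, Y i ω ∂μ - √(2 * W * L)} = ∅ := by
      ext ω
      simp only [Set.mem_ofPred_eq, Set.mem_empty_iff_false, iff_false, not_lt]
      have h1 : 0 ≤ ∑ i, Y i ω := Finset.sum_nonneg fun i _ => hY0 i ω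
      linarith [Real.sqrt_nonneg (2 * W * L)]
    rw [this]
    simp [Real.exp_nonneg]
  · set w := √(2 * L / W) with hw
    have hwpos : 0 < w := Real.sqrt_pos.mpr (by positivity)
    have hw2 : W * w ^ 2 = 2 * L := by
      rw [hw, Real.sq_sqrt (by positivity)]; field_simp
    have hwW : √(2 * W * L) = W * w := by
      rw [Real.sqrt_eq_iff_mul_self_eq (by positivity) (by positivity)]
      linear_combination (-W) * hw2
    have hind' : iIndepFun (fun i ω => - Y i ω) μ := hind.comp (fun _ x => -x)
      (fun _ => measurable_neg)
    have h := measureReal_le_sum_le_exp hind' (fun i => (hY i).neg) hwpos.le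
      (G := fun i ω => -(w * Y i ω) + w ^ 2 / 2 * Y i ω ^ 2)
      (fun i => ((hint i).const_mul _).neg.add ((hint2 i).const_mul _))
      (fun i ω => by
        have := exp_neg_le_one_sub_add_sq (mul_nonneg hwpos.le (hY0 i ω))
        rw [mul_neg]
        refine this.trans_eq ?_
        ring) (W * w - ∑ i, ∫ ω, Y i ω ∂μ)
    refine (measureReal_mono (fun ω hω => ?_)).trans (h.trans ?_)
    · simp only [Set.mem_ofPred_eq, hwW, Finset.sum_neg_distrib] at hω ⊢
      linarith
    · rw [Real.exp_le_exp]
      have hG : ∑ i, ∫ ω, (-(w * Y i ω) + w ^ 2 / 2 * Y i ω ^ 2) ∂μ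
          ≤ - w * ∑ i, ∫ ω, Y i ω ∂μ + w ^ 2 / 2 * W := by
        calc _ ≤ ∑ i, (-w * ∫ ω, Y i ω ∂μ + w ^ 2 / 2 * (K * ∫ ω, Y i ω ∂μ)) := by
              refine Finset.sum_le_sum fun i _ => ?_
              rw [integral_add (f := fun ω => -(w * Y i ω)) ((hint i).const_mul _).neg
                  ((hint2 i).const_mul _),
                integral_neg, integral_const_mul, integral_const_mul, neg_mul,
                ← integral_const_mul K]
              refine add_le_add le_rfl (mul_le_mul_of_nonneg_left ?_ (by positivity))
              -- Since `0 ≤ Y ≤ K`, the second moment is at most `K` times the mean.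
              refine integral_mono (hint2 i) ((hint i).const_mul K) fun ω => ?_
              simp only [sq]
              exact mul_le_mul_of_nonneg_right (hK i ω) (hY0 i ω)
          _ = - w * ∑ i, ∫ ω, Y i ω ∂μ + w ^ 2 / 2 * (K * ∑ i, ∫ ω, Y i ω ∂μ) := by
              rw [Finset.sum_add_distrib, ← Finset.mul_sum, ← Finset.mul_sum, ← Finset.mul_sum]
          _ ≤ _ := by gcongr
      linarith

/-- Upper tail of a sum of nonnegative bounded independent variables. -/
lemma measureReal_lt_sum_le {Y : ι → Ω → ℝ} (hind : iIndepFun Y μ)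
    (hY : ∀ i, AEMeasurable (Y i) μ) {K L : ℝ} (hY0 : ∀ i ω, 0 ≤ Y i ω)
    (hK : ∀ i ω, Y i ω ≤ K) (hKpos : 0 < K) :
    μ.real {ω | 2 * ∑ i, ∫ ω, Y i ω ∂μ + K * L < ∑ i, Y i ω} ≤ Real.exp (-L) := by
  have := hind.isProbabilityMeasure
  have hint : ∀ i, Integrable (Y i) μ := fun i =>
    Integrable.of_bound (hY i).aestronglyMeasurable K (ae_of_all _ fun ω => by
      rw [Real.norm_eq_abs, abs_of_nonneg (hY0 i ω)]; exact hK i ω)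
  have h := measureReal_le_sum_le_exp hind hY (l := K⁻¹) (by positivity)
    (G := fun i ω => 2 * K⁻¹ * Y i ω) (fun i => (hint i).const_mul _)
    (fun i ω => by
      have := exp_le_one_add_two_mul (y := K⁻¹ * Y i ω)
        (mul_nonneg (by positivity) (hY0 i ω)) (by
          rw [inv_mul_le_iff₀ hKpos]; simpa using hK i ω)
      linarith) (2 * ∑ i, ∫ ω, Y i ω ∂μ + K * L)
  refine (measureReal_mono (fun ω hω => ?_)).trans (h.trans_eq ?_)
  · simp only [Set.mem_ofPred_eq] at hω ⊢
    exact hω.le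
  · congr 1
    simp only [integral_const_mul, ← Finset.mul_sum]
    field_simp
    ring

end RollingWindow

/-! ### The empirical Bernstein inequality -/

namespace RollingWindow

/-- If the deviation `D` of a sample mean obeys Bernstein's bound for the standard deviation `s`
and the sample standard deviation `v` is not much below `s`, then `D` obeys the empirical bound. -/
lemma empirical_deviation_le {M s v D y : ℝ} (hM : 0 < M) (hs0 : 0 ≤ s) (hs : s ≤ M / 2)
    (hv : 0 ≤ v) (hD : 0 ≤ D) (hy : 0 ≤ y) (h1 : D ≤ s * y + M * y ^ 2 / 6)
    (h2 : s ^ 2 - (M - s ^ 2 / M) * s * y - D ^ 2 ≤ v ^ 2) :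
    D ≤ v * y + 4 / 3 * M * y ^ 2 := by
  wlog hM1 : M = 1 generalizing M s v D
  · have h := this (M := 1) (s := s / M) (v := v / M) (D := D / M) one_pos (by positivity)
      (by rw [div_le_iff₀ hM]; linarith) (by positivity) (by positivity)
      (by
        rw [div_le_iff₀ hM]
        refine h1.trans_eq ?_
        field_simp)
      (by
        have h3 := div_le_div_of_nonneg_right h2 (sq_nonneg M)
        refine le_trans (le_of_eq ?_) (h3.trans_eq ?_) <;> field_simp)
      rfl
    rw [div_le_iff₀ hM] at h
    refine h.trans_eq ?_
    field_simp
  subst hM1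
  by_contra! hcon
  rw [div_one, mul_one] at *
  rcases hy.eq_or_lt with rfl | hypos
  · simp at h1 hcon; linarith
  -- If the claim fails, comparison with `h1` gives `v < s - (4/3 - 1/6) y`. Squaring and using `h2`
  -- would force `7/3 ≤ 1 - s² + (384/343) s² + 7/6`, which is false for `s² ≤ 1/4`. The term `-s²`,
  -- from using the range `M - s²/M` instead of `M`, offsets most of `D²`; these estimates do not
  -- close without it.
  have hvs : v < s - 7 / 6 * y := by nlinarith
  have hys : y ≤ 6 / 7 * s := by linarith
  have hspos : 0 < s := by linarith
  have hv2 : v ^ 2 ≤ (s - 7 / 6 * y) ^ 2 := pow_le_pow_left₀ hv hvs.le 2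
  have hD1 : D ≤ 8 / 7 * s * y := by nlinarith
  have hD2 : D ^ 2 ≤ 384 / 343 * s ^ 2 * (s * y) := by
    calc D ^ 2 ≤ (8 / 7 * s * y) ^ 2 := pow_le_pow_left₀ hD hD1 2
      _ = 64 / 49 * s ^ 2 * y * y := by ring
      _ ≤ 64 / 49 * s ^ 2 * y * (6 / 7 * s) := by gcongr
      _ = _ := by ring
  have hy2 : 49 / 36 * y ^ 2 ≤ 7 / 6 * (s * y) := by nlinarith
  have hs2 : s ^ 2 ≤ 1 / 4 := by nlinarith
  have hsy : 0 < s * y := mul_pos hspos hypos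
  have hfin : s ^ 2 * (s * y) ≤ 1 / 4 * (s * y) := by gcongr
  nlinarith

variable {Ω ι : Type*} [MeasurableSpace Ω] {μ : Measure Ω} [Fintype ι]

lemma sum_sub_mean_sq {x : ι → ℝ} {n m : ℝ} (hn : n = Fintype.card ι) (hn0 : n ≠ 0)
    (hm : m = n⁻¹ * ∑ i, x i) (c : ℝ) :
    ∑ i, (x i - m) ^ 2 = ∑ i, (x i - c) ^ 2 - n * (m - c) ^ 2 := by
  have hsum : ∑ i, x i = n * m := by rw [hm]; field_simp
  have h : ∀ i, (x i - m) ^ 2 = (x i - c) ^ 2 - 2 * (m - c) * x i + (m ^ 2 - c ^ 2) := by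
    intro i; ring
  simp_rw [h, Finset.sum_add_distrib, Finset.sum_sub_distrib, ← Finset.mul_sum, hsum,
    Finset.sum_const, Finset.card_univ, nsmul_eq_mul, ← hn]
  ring

/-- The deterministic step of the empirical Bernstein inequality: bounds for the mean and the second
moment about the expectation give bounds in terms of the sample variance. -/
lemma empirical_bounds_of_mean_bounds {x : ι → ℝ} {n M L s y c xbar v : ℝ} (hM : 0 < M)
    (hn : n = Fintype.card ι) (hn2 : 2 ≤ n) (hxbar : xbar = n⁻¹ * ∑ i, x i)
    (hv : v = √(1 / (n - 1) * ∑ i, (x i - xbar) ^ 2)) (hs0 : 0 ≤ s) (hsM : s ≤ M / 2)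
    (hy0 : 0 ≤ y) (hy : n * y ^ 2 = 2 * L)
    (h1 : n * (xbar - c) ≤ n * (s * y) + M * L / 3)
    (h2 : -(n * (xbar - c)) ≤ n * (s * y) + M * L / 3)
    (h3 : n * s ^ 2 - n * ((M - s ^ 2 / M) * s * y) ≤ ∑ i, (x i - c) ^ 2)
    (h4 : ∑ i, (x i - c) ^ 2 ≤ 2 * (n * s ^ 2) + M ^ 2 * L) :
    |xbar - c| ≤ v * y + 8 * M * L / (3 * (n - 1)) ∧
      v ^ 2 ≤ (2 * (n * s ^ 2) + M ^ 2 * L) / (n - 1) := by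
  have hnpos : 0 < n := by linarith
  have hv0 : 0 ≤ v := by rw [hv]; exact Real.sqrt_nonneg _
  have hvsq : v ^ 2 * (n - 1) = ∑ i, (x i - c) ^ 2 - n * (xbar - c) ^ 2 := by
    rw [hv, Real.sq_sqrt, sum_sub_mean_sq hn hnpos.ne' hxbar c]
    · field_simp [show n - 1 ≠ 0 by linarith]
    · exact mul_nonneg (one_div_nonneg.mpr (by linarith))
        (Finset.sum_nonneg fun i _ => sq_nonneg _)
  constructor
  · have hD : |xbar - c| ≤ s * y + M * y ^ 2 / 6 := by
      rw [abs_le]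
      constructor
      · refine le_of_mul_le_mul_left (a := n) ?_ hnpos
        linear_combination h2 - (M / 6) * hy
      · refine le_of_mul_le_mul_left (a := n) ?_ hnpos
        linear_combination h1 - (M / 6) * hy
    have hv2 : s ^ 2 - (M - s ^ 2 / M) * s * y - |xbar - c| ^ 2 ≤ v ^ 2 := by
      rw [sq_abs]
      refine le_of_mul_le_mul_left (a := n) ?_ hnpos
      linear_combination h3 - hvsq + sq_nonneg v
    refine (empirical_deviation_le hM hs0 hsM hv0 (abs_nonneg _) hy0 hD hv2).trans
      (add_le_add le_rfl ?_)
    rw [le_div_iff₀ (by linarith)]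
    -- As `n y² = 2L`, the term `(4/3) M y²` is `8ML/(3n)`, at most the claimed `8ML/(3(n - 1))`.
    have : M * y ^ 2 * (n - 1) ≤ M * (2 * L) := by
      rw [← hy]; nlinarith [mul_nonneg hM.le (sq_nonneg y)]
    linarith
  · rw [le_div_iff₀ (by linarith)]
    have : 0 ≤ n * (xbar - c) ^ 2 := by positivity
    linarith

/-- The second moment about `c` is the variance plus the squared bias. -/
lemma integral_sub_const_sq [IsProbabilityMeasure μ] {X : Ω → ℝ} (hX : MemLp X 2 μ) (c : ℝ) :
    ∫ ω, (X ω - c) ^ 2 ∂μ = Var[X; μ] + (∫ ω, X ω ∂μ - c) ^ 2 := by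
  have h := variance_eq_sub (hX.sub (memLp_const c))
  have hv : Var[X - fun _ => c; μ] = Var[X; μ] := variance_sub_const hX.aestronglyMeasurable c
  have hi : ∫ ω, (X - fun _ => c : Ω → ℝ) ω ∂μ = ∫ ω, X ω ∂μ - c := by
    simp only [Pi.sub_apply]
    rw [integral_sub (hX.integrable one_le_two) (integrable_const _)]
    simp
  rw [hv, hi] at h
  have h2 : ∫ ω, ((X - fun _ => c) ^ 2 : Ω → ℝ) ω ∂μ = ∫ ω, (X ω - c) ^ 2 ∂μ := rfl
  linarith

/-- The empirical Bernstein inequality for bounded independent, not necessarily identically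
distributed, variables, together with an upper bound on the sample variance. -/
theorem empirical_bernstein {u : ι → Ω → ℝ} (hind : iIndepFun u μ)
    (hmeas : ∀ i, AEMeasurable (u i) μ) {lo M L : ℝ} (hM : 0 < M) (hL : 0 < L)
    (hu : ∀ i ω, u i ω ∈ Set.Icc lo (lo + M)) {n mbar s2 : ℝ}
    (hn_def : n = Fintype.card ι) (hn2 : 2 ≤ n)
    (hmbar : mbar = n⁻¹ * ∑ i, ∫ ω, u i ω ∂μ)
    (hs2 : s2 = n⁻¹ * ∑ i, ∫ ω, (u i ω - mbar) ^ 2 ∂μ) {ubar v : Ω → ℝ}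
    (hubar : ∀ ω, ubar ω = n⁻¹ * ∑ i, u i ω)
    (hv : ∀ ω, v ω = √(1 / (n - 1) * ∑ i, (u i ω - ubar ω) ^ 2)) :
    μ.real {ω | ¬ (|ubar ω - mbar| ≤ v ω * √(2 * L / n)
          + 8 * M * L / (3 * (n - 1)) ∧
        v ω ^ 2 ≤ (2 * (n * s2) + M ^ 2 * L) / (n - 1))}
      ≤ 4 * Real.exp (-L) := by
  have := hind.isProbabilityMeasure
  have hnpos : 0 < n := by linarith
  have hint : ∀ i, Integrable (u i) μ := fun i =>
    Integrable.of_mem_Icc lo (lo + M) (hmeas i) (ae_of_all _ (hu i))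
  have hmemLp : ∀ i, MemLp (u i) 2 μ := fun i =>
    MemLp.of_bound (hmeas i).aestronglyMeasurable (|lo| + M) (ae_of_all _ fun ω => by
      have := hu i ω
      rw [Real.norm_eq_abs, abs_le]
      constructor <;> linarith [this.1, this.2, neg_abs_le lo, le_abs_self lo])
  have hintc : ∀ c i, Integrable (fun ω => (u i ω - c) ^ 2) μ := fun c i =>
    ((hmemLp i).sub (memLp_const c)).integrable_sq
  have hm_mem : ∀ i, ∫ ω, u i ω ∂μ ∈ Set.Icc lo (lo + M) := fun i => by
    constructor
    · simpa using integral_mono (integrable_const (μ := μ) lo) (hint i) (fun ω => (hu i ω).1)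
    · simpa using integral_mono (hint i) (integrable_const (μ := μ) (lo + M))
        (fun ω => (hu i ω).2)
  have hmsum : ∑ i, ∫ ω, u i ω ∂μ = n * mbar := by rw [hmbar]; field_simp
  have hs2sum : ∑ i, ∫ ω, (u i ω - mbar) ^ 2 ∂μ = n * s2 := by rw [hs2]; field_simp
  have hs2_nonneg : 0 ≤ s2 := by
    rw [hs2]
    exact mul_nonneg (by positivity)
      (Finset.sum_nonneg fun i _ => integral_nonneg fun ω => sq_nonneg _)
  have hmbar_mem : mbar ∈ Set.Icc lo (lo + M) := by
    constructor
    · have : n * lo ≤ n * mbar := by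
        rw [← hmsum, hn_def, ← nsmul_eq_mul, ← Finset.card_univ]
        exact Finset.card_nsmul_le_sum _ _ _ fun i _ => (hm_mem i).1
      exact le_of_mul_le_mul_left this hnpos
    · have : n * mbar ≤ n * (lo + M) := by
        rw [← hmsum, hn_def, ← nsmul_eq_mul, ← Finset.card_univ]
        exact Finset.sum_le_card_nsmul _ _ _ fun i _ => (hm_mem i).2
      exact le_of_mul_le_mul_left this hnpos
  -- the variance is at most the product of the distances of the mean to the end points
  have hs2_le : s2 ≤ (mbar - lo) * (lo + M - mbar) := by
    have hi : ∀ i, ∫ ω, (u i ω - mbar) ^ 2 ∂μ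
        ≤ (mbar - lo) * (lo + M - mbar) + (2 * lo + M - 2 * mbar) * (∫ ω, u i ω ∂μ - mbar) := by
      intro i
      have h1 : Integrable (fun ω => (mbar - lo) * (lo + M - mbar)
          + (2 * lo + M - 2 * mbar) * (u i ω - mbar)) μ :=
        (integrable_const _).add (((hint i).sub (integrable_const _)).const_mul _)
      refine (integral_mono (hintc mbar i) h1 fun ω => ?_).trans_eq ?_
      · have := mul_nonneg (sub_nonneg.mpr (hu i ω).1) (sub_nonneg.mpr (hu i ω).2)
        simp only
        nlinarith
      · have h2 : Integrable (fun ω => u i ω - mbar) μ := (hint i).sub (integrable_const _)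
        rw [integral_add (integrable_const _) (h2.const_mul _),
          integral_const, integral_const_mul, integral_sub (hint i) (integrable_const _)]
        simp
    have hsum := Finset.sum_le_sum fun i (_ : i ∈ Finset.univ) => hi i
    rw [hs2sum, Finset.sum_add_distrib, Finset.sum_const, ← Finset.mul_sum,
      Finset.sum_sub_distrib, hmsum, Finset.sum_const] at hsum
    simp only [Finset.card_univ, nsmul_eq_mul, ← hn_def, sub_self, mul_zero, add_zero] at hsum
    exact le_of_mul_le_mul_left hsum hnpos
  set s := √s2 with hs_def
  have hs0 : 0 ≤ s := Real.sqrt_nonneg _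
  have hssq : s ^ 2 = s2 := Real.sq_sqrt hs2_nonneg
  have hsM : s ≤ M / 2 := by
    refine abs_le_of_sq_le_sq' ?_ (by positivity) |>.2
    nlinarith [sq_nonneg (2 * mbar - 2 * lo - M)]
  -- If `p + q = M` are the distances from `mbar` to the end points, then `s² ≤ pq` and `p, q ≤ M -
  -- pq/M`. So `m` bounds all deviations from `mbar`, improving on `M`.
  set m := M - s ^ 2 / M with hm_def
  have hmM : M * m = M ^ 2 - s2 := by rw [hm_def, hssq]; field_simp
  have hm0 : 0 ≤ m := by
    refine le_of_mul_le_mul_left (a := M) ?_ hM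
    rw [hmM]; nlinarith
  have hdev : ∀ i ω, |u i ω - mbar| ≤ m := by
    intro i ω
    obtain ⟨ha, hb⟩ := hmbar_mem
    obtain ⟨hc, hd⟩ := hu i ω
    have h1 : mbar - lo ≤ m := by
      refine le_of_mul_le_mul_left (a := M) ?_ hM
      rw [hmM]; nlinarith
    have h2 : lo + M - mbar ≤ m := by
      refine le_of_mul_le_mul_left (a := M) ?_ hM
      rw [hmM]; nlinarith
    rw [abs_le]; constructor <;> linarith
  have hmleM : m ≤ M := by
    rw [hm_def]; linarith [show 0 ≤ s ^ 2 / M by positivity]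
  set y := √(2 * L / n) with hy_def
  have hy0 : 0 ≤ y := Real.sqrt_nonneg _
  have hysq : n * y ^ 2 = 2 * L := by
    rw [hy_def, Real.sq_sqrt (by positivity)]; field_simp
  -- the four deviation events
  have hvar : ∀ i, ∫ ω, (u i ω - ∫ ω, u i ω ∂μ) ^ 2 ∂μ ≤ ∫ ω, (u i ω - mbar) ^ 2 ∂μ := by
    intro i
    rw [integral_sub_const_sq (hmemLp i), integral_sub_const_sq (hmemLp i)]
    simp [sq_nonneg]
  have hsqrtV : √(2 * (n * s2) * L) = n * (s * y) := by
    rw [Real.sqrt_eq_iff_mul_self_eq (by positivity) (by positivity)]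
    rw [← hssq]
    linear_combination (-(n * s ^ 2)) * hysq
  have habs : ∀ i ω, |u i ω - ∫ ω, u i ω ∂μ| ≤ M := fun i ω => by
    have h1 := hu i ω
    have h2 := hm_mem i
    rw [abs_le]; constructor <;> linarith [h1.1, h1.2, h2.1, h2.2]
  have hcent : ∀ i, ∫ ω, (u i ω - ∫ ω, u i ω ∂μ) ∂μ = 0 := fun i => by
    rw [integral_sub (hint i) (integrable_const _)]; simp
  -- Each variable is centred at its own mean. The total deviation is the same as from `mbar`, and
  -- the variances are at most the second moments about `mbar`.
  have hA : μ.real {ω | √(2 * (n * s2) * L) + M * L / 3 < ∑ i, (u i ω - ∫ ω, u i ω ∂μ)}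
      ≤ Real.exp (-L) :=
    measureReal_bernstein_lt_sum_le
      (hind.comp (fun i x => x - ∫ ω, u i ω ∂μ) fun i => measurable_id.sub_const _)
      (fun i => (hmeas i).sub_const _) habs hcent
      (by rw [← hs2sum]; exact Finset.sum_le_sum fun i _ => hvar i) hM.le hL
  have hA' : μ.real {ω | √(2 * (n * s2) * L) + M * L / 3 < ∑ i, -(u i ω - ∫ ω, u i ω ∂μ)}
      ≤ Real.exp (-L) :=
    measureReal_bernstein_lt_sum_le (X := fun i ω => -(u i ω - ∫ ω, u i ω ∂μ))
      (hind.comp (fun i x => -(x - ∫ ω, u i ω ∂μ)) fun i => (measurable_id.sub_const _).neg)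
      (fun i => ((hmeas i).sub_const _).neg) (fun i ω => by rw [abs_neg]; exact habs i ω)
      (fun i => by rw [integral_neg, hcent i, neg_zero])
      (by
        rw [← hs2sum]
        refine Finset.sum_le_sum fun i _ => ?_
        simp only [neg_sq]
        exact hvar i) hM.le hL
  have hYind : iIndepFun (fun i ω => (u i ω - mbar) ^ 2) μ :=
    hind.comp (fun _ x => (x - mbar) ^ 2) fun _ => (measurable_id.sub_const _).pow_const 2
  have hYmeas : ∀ i, AEMeasurable (fun ω => (u i ω - mbar) ^ 2) μ := fun i =>
    ((hmeas i).sub_const _).pow_const 2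
  have hYm : ∀ i ω, (u i ω - mbar) ^ 2 ≤ m ^ 2 := fun i ω => by
    rw [← sq_abs]; exact pow_le_pow_left₀ (abs_nonneg _) (hdev i ω) 2
  have hB := measureReal_sum_lt_le hYind hYmeas (L := L) (fun i ω => sq_nonneg _) hYm
    (W := m ^ 2 * (n * s2)) (by rw [hs2sum]) hL
  have hsqrtW : √(2 * (m ^ 2 * (n * s2)) * L) = n * (m * s * y) := by
    rw [Real.sqrt_eq_iff_mul_self_eq (by positivity) (by positivity)]
    rw [← hssq]
    linear_combination (-(n * s ^ 2 * m ^ 2)) * hysq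
  have hC := measureReal_lt_sum_le hYind hYmeas (L := L) (fun i ω => sq_nonneg _)
    (fun i ω => (hYm i ω).trans (pow_le_pow_left₀ hm0 hmleM 2)) (by positivity)
  rw [hs2sum, hsqrtW] at hB
  rw [hs2sum] at hC
  rw [hsqrtV] at hA hA'
  set EA := {ω | n * (s * y) + M * L / 3 < ∑ i, (u i ω - ∫ ω, u i ω ∂μ)}
  set EA' := {ω | n * (s * y) + M * L / 3 < ∑ i, -(u i ω - ∫ ω, u i ω ∂μ)}
  set EB := {ω | ∑ i, (u i ω - mbar) ^ 2 < n * s2 - n * (m * s * y)}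
  set EC := {ω | 2 * (n * s2) + M ^ 2 * L < ∑ i, (u i ω - mbar) ^ 2}
  have hsub : {ω | ¬ (|ubar ω - mbar| ≤ v ω * y + 8 * M * L / (3 * (n - 1)) ∧
        v ω ^ 2 ≤ (2 * (n * s2) + M ^ 2 * L) / (n - 1))} ⊆ EA ∪ EA' ∪ EB ∪ EC := by
    intro ω hω
    by_contra hcon
    simp only [EA, EA', EB, EC, Set.mem_union, Set.mem_ofPred_eq, not_or, not_lt] at hcon
    obtain ⟨⟨⟨h1, h2⟩, h3⟩, h4⟩ := hcon
    refine hω ?_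
    have hus : ∑ i, u i ω = n * ubar ω := by rw [hubar]; field_simp
    rw [Finset.sum_neg_distrib] at h2
    rw [Finset.sum_sub_distrib, hus, hmsum] at h1 h2
    rw [← hssq] at h3 h4 ⊢
    exact empirical_bounds_of_mean_bounds hM hn_def hn2 (hubar ω) (hv ω) hs0 hsM hy0 hysq
      (by linarith) (by linarith) h3 h4
  calc _ ≤ μ.real (EA ∪ EA' ∪ EB ∪ EC) := measureReal_mono hsub
    _ ≤ μ.real EA + μ.real EA' + μ.real EB + μ.real EC :=
        (measureReal_union_le _ _).trans (add_le_add_left ((measureReal_union_le _ _).trans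
          (add_le_add_left (measureReal_union_le _ _) _)) _)
    _ ≤ _ := by linarith

end RollingWindow

/-! ### Windows, the selection rule and the size of the variance proxy -/

namespace RollingWindow

lemma window_subset_window {t i k : ℕ} (h : i ≤ k) : window t i ⊆ window t k :=
  Finset.Icc_subset_Icc_left (by omega)

lemma window_subset_Icc (t k : ℕ) : window t k ⊆ Finset.Icc 1 t :=
  Finset.Icc_subset_Icc_left (by omega)

lemma self_mem_window {t k : ℕ} (hk : k ∈ Finset.Icc 1 t) : t ∈ window t k := by
  rw [Finset.mem_Icc] at hk
  simp only [window, Finset.mem_Icc]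
  omega

lemma windowSize_pos {B : ℕ → ℕ} {t k : ℕ} (hB : ∀ j ∈ Finset.Icc 1 t, 1 ≤ B j)
    (hk : k ∈ Finset.Icc 1 t) : 0 < windowSize B t k :=
  Finset.sum_pos (fun j hj => hB j (window_subset_Icc t k hj)) ⟨t, self_mem_window hk⟩

lemma weighted_mean_sub_le {B : ℕ → ℕ} {t k : ℕ} (hpos : 0 < windowSize B t k) {g : ℕ → ℝ}
    {θ β : ℝ} (hβ : ∀ j ∈ window t k, |g j - θ| ≤ β) :
    |(windowSize B t k : ℝ)⁻¹ * ∑ j ∈ window t k, B j * g j - θ| ≤ β := by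
  have hn : (0 : ℝ) < windowSize B t k := by exact_mod_cast hpos
  have hsum : (windowSize B t k : ℝ) = ∑ j ∈ window t k, (B j : ℝ) := by
    simp [windowSize]
  have h1 : (windowSize B t k : ℝ)⁻¹ * ∑ j ∈ window t k, B j * g j - θ
      = (windowSize B t k : ℝ)⁻¹ * ∑ j ∈ window t k, B j * (g j - θ) := by
    simp_rw [mul_sub, Finset.sum_sub_distrib, ← Finset.sum_mul, ← hsum]
    field_simp
  rw [h1, abs_mul, abs_of_pos (inv_pos.mpr hn), inv_mul_le_iff₀ hn]
  calc |∑ j ∈ window t k, B j * (g j - θ)| ≤ ∑ j ∈ window t k, |B j * (g j - θ)| :=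
        Finset.abs_sum_le_sum_abs _ _
    _ ≤ ∑ j ∈ window t k, B j * β := Finset.sum_le_sum fun j hj => by
        rw [abs_mul, Nat.abs_cast]
        exact mul_le_mul_of_nonneg_left (hβ j hj) (Nat.cast_nonneg _)
    _ = _ := by rw [← Finset.sum_mul, ← hsum]

section Selection

variable {B : ℕ → ℕ} {u : (j : ℕ) → Fin (B j) → ℝ} {M δ : ℝ} {t k : ℕ}

lemma le_phiHat {i : ℕ} (hi : i ∈ Finset.Icc 1 k) :
    |muHat u t k - muHat u t i| - (psiHat u M δ t k + psiHat u M δ t i) ≤ phiHat u M δ t k :=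
  (le_max_left _ 0).trans (le_ciSup (f := fun i : Finset.Icc 1 k =>
    max (|muHat u t k - muHat u t i| - (psiHat u M δ t k + psiHat u M δ t i)) 0)
    (Set.finite_range _).bddAbove ⟨i, hi⟩)

lemma phiHat_nonneg : 0 ≤ phiHat u M δ t k :=
  Real.iSup_nonneg fun _ => le_max_right _ _

/-- If each window average is within `ψ̂` of its centre `A i`, and the centres of all windows up to
`k` are within `β` of `θ`, then the average over the selected window is close to `θ`. -/
lemma abs_muHat_selected_sub_le {khat : ℕ} {A : ℕ → ℝ} {θ β : ℝ} (hk : k ∈ Finset.Icc 1 t)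
    (hsel : IsSelectedWindow u M δ t khat)
    (hdev : ∀ i ∈ Finset.Icc 1 t, |muHat u t i - A i| ≤ psiHat u M δ t i)
    (hbias : ∀ i ∈ Finset.Icc 1 k, |A i - θ| ≤ β) :
    |muHat u t khat - θ| ≤ 5 * β + 3 * psiHat u M δ t k := by
  obtain ⟨hkhat, hmin⟩ := hsel
  have hk' := Finset.mem_Icc.mp hk
  have hkhat' := Finset.mem_Icc.mp hkhat
  have hkk : k ∈ Finset.Icc 1 k := Finset.mem_Icc.mpr ⟨hk'.1, le_rfl⟩
  have hβ : 0 ≤ β := (abs_nonneg _).trans (hbias k hkk)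
  have hdk := abs_le.mp (hdev k hk)
  have hbk := abs_le.mp (hbias k hkk)
  -- The two fluctuations are absorbed by the subtracted `ψ̂` terms, leaving only two biases.
  have hphi : phiHat u M δ t k ≤ 2 * β := by
    refine Real.iSup_le (fun i => max_le ?_ (by positivity)) (by positivity)
    have hi' := Finset.mem_Icc.mp i.2
    have h1 := abs_le.mp (hdev i (Finset.mem_Icc.mpr ⟨hi'.1, hi'.2.trans hk'.2⟩))
    have h2 := abs_le.mp (hbias i i.2)
    rw [sub_le_iff_le_add, abs_le]
    constructor <;> linarith [h1.1, h1.2, h2.1, h2.2, hdk.1, hdk.2, hbk.1, hbk.2]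
  have hle := hmin k hk
  have hphi0 : 0 ≤ phiHat u M δ t khat := phiHat_nonneg
  -- The larger of the two windows has the smaller one among its comparisons, so its `φ̂` controls
  -- the difference. Minimality bounds `φ̂ + ψ̂` at `khat` by its value at `k`; for `khat ≤ k` this
  -- is used for `ψ̂` at `khat` alone, dropping `φ̂ ≥ 0`.
  have hclose : |muHat u t khat - muHat u t k| ≤ 4 * β + 2 * psiHat u M δ t k := by
    rcases le_total khat k with h | h
    · have := le_phiHat (u := u) (M := M) (δ := δ) (t := t)
        (Finset.mem_Icc.mpr ⟨hkhat'.1, h⟩ : khat ∈ Finset.Icc 1 k)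
      rw [abs_sub_comm] at this
      linarith
    · have := le_phiHat (u := u) (M := M) (δ := δ) (t := t)
        (Finset.mem_Icc.mpr ⟨hk'.1, h⟩ : k ∈ Finset.Icc 1 khat)
      linarith
  have hc := abs_le.mp hclose
  rw [abs_le]
  constructor <;> linarith [hc.1, hc.2, hdk.1, hdk.2, hbk.1, hbk.2]

end Selection

/-- The variance proxy is of the order of the oracle bound when the sample variance is controlled
by the average variance and the squared bias. -/
lemma variance_proxy_le {n v s2 σ β r L : ℝ} (hn : 2 ≤ n) (hL : 1 ≤ L) (hr : 0 ≤ r) (hσ : 0 ≤ σ)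
    (hβ : 0 ≤ β) (hs2 : s2 ≤ σ ^ 2 + 4 * β ^ 2) (hs20 : 0 ≤ s2)
    (hv2 : v ^ 2 ≤ (2 * (n * s2) + (2 * r) ^ 2 * L) / (n - 1)) :
    v * √(2 * L / n) + 8 * (2 * r) * L / (3 * (n - 1))
      ≤ 15 * max 1 r * L * (β + σ / √n + 1 / n) := by
  have hn0 : 0 < n := by linarith
  have hL0 : 0 ≤ L := by linarith
  set q := √(2 * L / n) with hq
  have hq0 : 0 ≤ q := Real.sqrt_nonneg _
  have hqsq : q ^ 2 = 2 * L / n := Real.sq_sqrt (by positivity)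
  have hinv : 1 / (n - 1) ≤ 2 / n := by
    rw [div_le_div_iff₀ (by linarith) hn0]; linarith
  have hv3 : v ^ 2 ≤ (2 * σ + 4 * β + 2 * r * q) ^ 2 := by
    have h1 : (2 * (n * s2) + (2 * r) ^ 2 * L) / (n - 1)
        ≤ (2 * (n * s2) + (2 * r) ^ 2 * L) * (2 / n) := by
      rw [div_eq_mul_one_div]
      exact mul_le_mul_of_nonneg_left hinv (by positivity)
    have h2 : (2 * (n * s2) + (2 * r) ^ 2 * L) * (2 / n) = 4 * s2 + (2 * r) ^ 2 * q ^ 2 := by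
      rw [hqsq]; field_simp; ring
    have h3 : 0 ≤ σ * β := by positivity
    have h4 : 0 ≤ σ * (r * q) := by positivity
    have h5 : 0 ≤ β * (r * q) := by positivity
    nlinarith
  have hv4 : v ≤ 2 * σ + 4 * β + 2 * r * q := (abs_le_of_sq_le_sq' hv3 (by positivity)).2
  have hsn : 1 ≤ √n := by rw [Real.one_le_sqrt]; linarith
  -- Since `L ≥ 1`, `√(2L) ≤ 2L`: the bound is kept linear in the logarithm.
  have hq1 : q ≤ 2 * L / √n := by
    rw [hq, Real.sqrt_div (by positivity)]
    gcongr
    rw [Real.sqrt_le_left (by positivity)]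
    nlinarith
  have hq2 : q ≤ 2 * L := hq1.trans (div_le_self (by positivity) hsn)
  have hvq : v * q ≤ 4 * L * (σ / √n) + 8 * L * β + 4 * r * L / n := by
    calc v * q ≤ (2 * σ + 4 * β + 2 * r * q) * q := by gcongr
      _ = 2 * σ * q + 4 * β * q + 2 * r * q ^ 2 := by ring
      _ ≤ 2 * σ * (2 * L / √n) + 4 * β * (2 * L) + 2 * r * (2 * L / n) := by
          rw [hqsq]; gcongr
      _ = _ := by ring
  have h8 : 8 * (2 * r) * L / (3 * (n - 1)) ≤ 32 / 3 * r * L / n := by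
    calc 8 * (2 * r) * L / (3 * (n - 1)) = 16 / 3 * r * L * (1 / (n - 1)) := by
          field_simp [show n - 1 ≠ 0 by linarith]; ring
      _ ≤ 16 / 3 * r * L * (2 / n) := by gcongr
      _ = _ := by ring
  set K := max 1 r with hK
  have hK1 : 1 ≤ K := le_max_left _ _
  have hrK : r ≤ K := le_max_right _ _
  have e1 : L * (σ / √n) ≤ K * L * (σ / √n) := by
    have : 0 ≤ L * (σ / √n) := by positivity
    nlinarith
  have e2 : L * β ≤ K * L * β := by
    have : 0 ≤ L * β := by positivity
    nlinarith
  have e3 : r * (L / n) ≤ K * (L / n) := by gcongr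
  have p1 : 0 ≤ K * L * (σ / √n) := by positivity
  have p2 : 0 ≤ K * L * β := by positivity
  have p3 : 0 ≤ K * (L / n) := by positivity
  have f1 : 4 * r * L / n = 4 * (r * (L / n)) := by ring
  have f2 : 32 / 3 * r * L / n = 32 / 3 * (r * (L / n)) := by ring
  have f3 : 15 * K * L * (β + σ / √n + 1 / n)
      = 15 * (K * L * β) + 15 * (K * L * (σ / √n)) + 15 * (K * (L / n)) := by ring
  rw [f1] at hvq
  rw [f2] at h8
  rw [f3]
  -- The coefficients are 8 for the drift, 4 for the deviation, and `4 + 32/3 = 44/3` for `1/n`, all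
  -- at most 15.
  linarith

/-! ### Probability that a single window misbehaves -/

section Comparison

variable {F Z Ω : Type*} [MeasurableSpace Z] [MeasurableSpace Ω] {ℓ : F → Z → ℝ} {f₁ f₂ : F}
  {P : ℕ → Measure Z} {B : ℕ → ℕ} {t k : ℕ}

/-- The mean over the window of the gaps `Δ_j`, weighted by the sample sizes. -/
noncomputable def meanGap (ℓ : F → Z → ℝ) (P : ℕ → Measure Z) (B : ℕ → ℕ) (f₁ f₂ : F)
    (t k : ℕ) : ℝ :=
  (windowSize B t k : ℝ)⁻¹ * ∑ j ∈ window t k, B j * gap ℓ P f₁ f₂ j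

/-- The largest deviation over the window of `Δ_j` from `Δ_t`. -/
noncomputable def maxDrift (ℓ : F → Z → ℝ) (P : ℕ → Measure Z) (f₁ f₂ : F) (t k : ℕ) : ℝ :=
  ⨆ j : window t k, |gap ℓ P f₁ f₂ j - gap ℓ P f₁ f₂ t|

lemma abs_gap_sub_le_maxDrift {j : ℕ} (hj : j ∈ window t k) :
    |gap ℓ P f₁ f₂ j - gap ℓ P f₁ f₂ t| ≤ maxDrift ℓ P f₁ f₂ t k :=
  le_ciSup (f := fun j : window t k => |gap ℓ P f₁ f₂ j - gap ℓ P f₁ f₂ t|)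
    (Set.finite_range _).bddAbove ⟨j, hj⟩

lemma maxDrift_nonneg : 0 ≤ maxDrift ℓ P f₁ f₂ t k :=
  Real.iSup_nonneg fun _ => abs_nonneg _

lemma sigmaTilde_nonneg : 0 ≤ sigmaTilde ℓ P B f₁ f₂ t k := Real.sqrt_nonneg _

lemma oracleBound_eq : oracleBound ℓ P B f₁ f₂ t k = maxDrift ℓ P f₁ f₂ t k
    + sigmaTilde ℓ P B f₁ f₂ t k / √(windowSize B t k : ℝ) + 1 / (windowSize B t k : ℝ) := rfl

lemma maxDrift_le_oracleBound : maxDrift ℓ P f₁ f₂ t k ≤ oracleBound ℓ P B f₁ f₂ t k := by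
  rw [oracleBound_eq]
  have h1 : 0 ≤ sigmaTilde ℓ P B f₁ f₂ t k / √(windowSize B t k : ℝ) :=
    div_nonneg sigmaTilde_nonneg (Real.sqrt_nonneg _)
  have h2 : (0 : ℝ) ≤ 1 / (windowSize B t k : ℝ) := by positivity
  linarith

lemma oracleBound_nonneg : 0 ≤ oracleBound ℓ P B f₁ f₂ t k :=
  maxDrift_nonneg.trans maxDrift_le_oracleBound

lemma abs_meanGap_sub_le {i : ℕ} (hpos : 0 < windowSize B t i) (hik : i ≤ k) :
    |meanGap ℓ P B f₁ f₂ t i - gap ℓ P f₁ f₂ t| ≤ maxDrift ℓ P f₁ f₂ t k :=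
  weighted_mean_sub_le hpos fun _ hj => abs_gap_sub_le_maxDrift (window_subset_window hik hj)

/-- Sums over the samples of a window. -/
lemma sum_window_sigma (g : (j : ℕ) → Fin (B j) → ℝ) :
    ∑ p : (Σ j : window t k, Fin (B j)), g p.1 p.2 = ∑ j ∈ window t k, ∑ i, g j i := by
  rw [Fintype.sum_sigma]
  exact Finset.sum_coe_sort (window t k) fun j => ∑ i, g j i

lemma card_window_sigma : (windowSize B t k : ℝ) = Fintype.card (Σ j : window t k, Fin (B j)) := by
  rw [Fintype.card_sigma]
  simp only [Fintype.card_fin]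
  rw [Finset.sum_coe_sort (window t k) fun j => B j]
  rfl

/-- The average second moment of the loss differences about their mean is at most the average
variance plus four times the squared drift. -/
lemma average_sq_le [∀ j, IsProbabilityMeasure (P j)] (hpos : 0 < windowSize B t k)
    (hvar : ∀ j, MemLp (fun z => ℓ f₁ z - ℓ f₂ z) 2 (P j))
    (hgap : ∀ j, ∫ z, (ℓ f₁ z - ℓ f₂ z) ∂(P j) = gap ℓ P f₁ f₂ j) :
    (windowSize B t k : ℝ)⁻¹ * ∑ j ∈ window t k, (B j : ℝ) *
        ∫ z, (ℓ f₁ z - ℓ f₂ z - meanGap ℓ P B f₁ f₂ t k) ^ 2 ∂(P j)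
      ≤ sigmaTilde ℓ P B f₁ f₂ t k ^ 2 + 4 * maxDrift ℓ P f₁ f₂ t k ^ 2 := by
  have hn : (0 : ℝ) < windowSize B t k := by exact_mod_cast hpos
  have hsum : (windowSize B t k : ℝ) = ∑ j ∈ window t k, (B j : ℝ) := by
    simp [windowSize]
  have hσ : sigmaTilde ℓ P B f₁ f₂ t k ^ 2 = (windowSize B t k : ℝ)⁻¹ *
      ∑ j ∈ window t k, (B j : ℝ) * Var[fun z => ℓ f₁ z - ℓ f₂ z; P j] := by
    rw [sigmaTilde, Real.sq_sqrt, one_div]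
    exact mul_nonneg (by positivity) (Finset.sum_nonneg fun j _ =>
      mul_nonneg (Nat.cast_nonneg _) (variance_nonneg _ _))
  have hβ : 4 * maxDrift ℓ P f₁ f₂ t k ^ 2 = (windowSize B t k : ℝ)⁻¹ *
      ∑ j ∈ window t k, (B j : ℝ) * (4 * maxDrift ℓ P f₁ f₂ t k ^ 2) := by
    rw [← Finset.sum_mul, ← hsum]
    field_simp
  rw [hσ, hβ, ← mul_add, ← Finset.sum_add_distrib]
  gcongr with j hj
  rw [← mul_add, integral_sub_const_sq (hvar j), hgap j]
  gcongr
  have h1 := abs_le.mp (abs_gap_sub_le_maxDrift (ℓ := ℓ) (P := P) (f₁ := f₁) (f₂ := f₂) hj)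
  have h2 := abs_le.mp (abs_meanGap_sub_le (ℓ := ℓ) (P := P) (f₁ := f₁) (f₂ := f₂) hpos le_rfl)
  have h3 : |gap ℓ P f₁ f₂ j - meanGap ℓ P B f₁ f₂ t k| ≤ 2 * maxDrift ℓ P f₁ f₂ t k := by
    rw [abs_le]; constructor <;> linarith [h1.1, h1.2, h2.1, h2.2]
  calc (gap ℓ P f₁ f₂ j - meanGap ℓ P B f₁ f₂ t k) ^ 2
      = |gap ℓ P f₁ f₂ j - meanGap ℓ P B f₁ f₂ t k| ^ 2 := (sq_abs _).symm
    _ ≤ (2 * maxDrift ℓ P f₁ f₂ t k) ^ 2 := by gcongr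
    _ = _ := by ring

/-- A single window: its average is within `ψ̂` of its mean and `ψ̂` is of the order of the oracle
bound, except on an event of small probability. -/
theorem measureReal_window_bad_le [∀ j, IsProbabilityMeasure (P j)] {a b : ℝ}
    (hℓm : ∀ f, Measurable (ℓ f)) (hℓ : ∀ f z, ℓ f z ∈ Set.Icc a b) (hab : a < b)
    (hB : ∀ j ∈ Finset.Icc 1 t, 1 ≤ B j) {μ : Measure Ω} [IsProbabilityMeasure μ]
    {z : (j : ℕ) → Fin (B j) → Ω → Z}
    (hlaw : ∀ j ∈ Finset.Icc 1 t, ∀ i, HasLaw (z j i) (P j) μ)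
    (hind : iIndepFun (fun p : (Σ j : Finset.Icc 1 t, Fin (B j)) => z p.1 p.2) μ)
    (hk : k ∈ Finset.Icc 1 t) {δ : ℝ} (hL : 1 ≤ Real.log (2 / δ)) :
    μ.real {ω | ¬ (|muHat (lossDiff ℓ f₁ f₂ fun j i => z j i ω) t k - meanGap ℓ P B f₁ f₂ t k|
          ≤ psiHat (lossDiff ℓ f₁ f₂ fun j i => z j i ω) (2 * (b - a)) δ t k ∧
        psiHat (lossDiff ℓ f₁ f₂ fun j i => z j i ω) (2 * (b - a)) δ t k
          ≤ 15 * max 1 (b - a) * Real.log (2 / δ) * oracleBound ℓ P B f₁ f₂ t k)}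
      ≤ 4 * Real.exp (-Real.log (2 / δ)) := by
  have hpos := windowSize_pos hB hk
  have hdm : Measurable fun x => ℓ f₁ x - ℓ f₂ x := (hℓm f₁).sub (hℓm f₂)
  have hdmem : ∀ x, ℓ f₁ x - ℓ f₂ x ∈ Set.Icc (a - b) (a - b + 2 * (b - a)) := fun x => by
    have h1 := hℓ f₁ x
    have h2 := hℓ f₂ x
    constructor <;> linarith [h1.1, h1.2, h2.1, h2.2]
  have hℓint : ∀ f j, Integrable (ℓ f) (P j) := fun f j =>
    Integrable.of_mem_Icc a b (hℓm f).aemeasurable (ae_of_all _ (hℓ f))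
  have hgap : ∀ j, ∫ x, (ℓ f₁ x - ℓ f₂ x) ∂(P j) = gap ℓ P f₁ f₂ j := fun j =>
    integral_sub (hℓint f₁ j) (hℓint f₂ j)
  have hmem : ∀ j, MemLp (fun x => ℓ f₁ x - ℓ f₂ x) 2 (P j) := fun j =>
    MemLp.of_bound hdm.aestronglyMeasurable (b - a) (ae_of_all _ fun x => by
      have := hdmem x
      rw [Real.norm_eq_abs, abs_le]
      constructor <;> linarith [this.1, this.2])
  set n : ℝ := (windowSize B t k : ℝ) with hn
  set L := Real.log (2 / δ) with hLdef
  -- With a single sample nothing is random: average and mean both lie in `[a - b, b - a]`, so they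
  -- differ by at most `M`, and the oracle bound is at least `1 / 1`.
  by_cases hone : windowSize B t k = 1
  · refine le_trans (le_of_eq ?_) (by positivity : 0 ≤ 4 * Real.exp (-L))
    have hn1 : n = 1 := by rw [hn, hone]; simp
    have hgapmem : ∀ j, gap ℓ P f₁ f₂ j ∈ Set.Icc (a - b) (b - a) := fun j => by
      rw [← hgap j]
      have hi : Integrable (fun x => ℓ f₁ x - ℓ f₂ x) (P j) := (hℓint f₁ j).sub (hℓint f₂ j)
      constructor
      · simpa using integral_mono (integrable_const (μ := P j) (a - b)) hi
          (fun x => (hdmem x).1)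
      · have := integral_mono hi (integrable_const (μ := P j) (b - a))
          (fun x => show ℓ f₁ x - ℓ f₂ x ≤ b - a by linarith [(hdmem x).2])
        simpa using this
    have hmean : |meanGap ℓ P B f₁ f₂ t k - 0| ≤ b - a :=
      weighted_mean_sub_le hpos fun j _ => by
        rw [sub_zero, abs_le]
        exact ⟨by linarith [(hgapmem j).1], (hgapmem j).2⟩
    have hall : ∀ ω, |muHat (lossDiff ℓ f₁ f₂ fun j i => z j i ω) t k| ≤ b - a := by
      intro ω
      rw [muHat, ← hn, hn1, inv_one, one_mul, ← sum_window_sigma]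
      refine (Finset.abs_sum_le_sum_abs _ _).trans ?_
      refine (Finset.sum_le_card_nsmul _ _ (b - a) fun p _ => ?_).trans_eq ?_
      · have := hdmem (z p.1 p.2 ω)
        rw [lossDiff, abs_le]
        constructor <;> linarith [this.1, this.2]
      · rw [nsmul_eq_mul, Finset.card_univ, ← card_window_sigma, ← hn, hn1, one_mul]
    have hempty : {ω | ¬ (|muHat (lossDiff ℓ f₁ f₂ fun j i => z j i ω) t k
            - meanGap ℓ P B f₁ f₂ t k|
          ≤ psiHat (lossDiff ℓ f₁ f₂ fun j i => z j i ω) (2 * (b - a)) δ t k ∧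
        psiHat (lossDiff ℓ f₁ f₂ fun j i => z j i ω) (2 * (b - a)) δ t k
          ≤ 15 * max 1 (b - a) * L * oracleBound ℓ P B f₁ f₂ t k)} = ∅ := by
      refine Set.eq_empty_iff_forall_notMem.mpr fun ω hω => hω ?_
      rw [psiHat, if_pos hone]
      constructor
      · have h1 := abs_le.mp (hall ω)
        rw [sub_zero] at hmean
        have h2 := abs_le.mp hmean
        rw [abs_le]; constructor <;> linarith [h1.1, h1.2, h2.1, h2.2]
      · have hO : 1 ≤ oracleBound ℓ P B f₁ f₂ t k := by
          rw [oracleBound_eq, ← hn, hn1]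
          have h1 : 0 ≤ maxDrift ℓ P f₁ f₂ t k := maxDrift_nonneg
          have h2 : 0 ≤ sigmaTilde ℓ P B f₁ f₂ t k := sigmaTilde_nonneg
          simp only [Real.sqrt_one, div_one]
          linarith
        have hK : b - a ≤ max 1 (b - a) := le_max_right _ _
        have hK0 : 0 < max 1 (b - a) := lt_of_lt_of_le one_pos (le_max_left _ _)
        have hLO : 1 ≤ L * oracleBound ℓ P B f₁ f₂ t k := one_le_mul_of_one_le_of_one_le hL hO
        calc 2 * (b - a) ≤ 15 * max 1 (b - a) * 1 := by linarith
          _ ≤ 15 * max 1 (b - a) * (L * oracleBound ℓ P B f₁ f₂ t k) := by gcongr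
          _ = _ := by ring
    rw [hempty]
    simp
  · have hn2 : 2 ≤ n := by
      rw [hn]
      exact_mod_cast (show 2 ≤ windowSize B t k by omega)
    -- Independence of the window's samples is inherited along the embedding into all samples.
    have hinj : Function.Injective (fun p : (Σ j : window t k, Fin (B j)) =>
        (⟨⟨p.1, window_subset_Icc t k p.1.2⟩, p.2⟩ : Σ j : Finset.Icc 1 t, Fin (B j))) := by
      rintro ⟨⟨j, hj⟩, i⟩ ⟨⟨j', hj'⟩, i'⟩ h
      simp only [Sigma.mk.injEq, Subtype.mk.injEq] at h
      obtain ⟨rfl, h⟩ := h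
      rw [heq_iff_eq] at h
      rw [h]
    have hindu : iIndepFun (fun (p : Σ j : window t k, Fin (B j)) ω =>
        lossDiff ℓ f₁ f₂ (fun j i => z j i ω) p.1 p.2) μ :=
      (hind.precomp hinj).comp (fun _ x => ℓ f₁ x - ℓ f₂ x) fun _ => hdm
    have hlaw' : ∀ p : (Σ j : window t k, Fin (B j)), HasLaw (z p.1 p.2) (P p.1) μ := fun p =>
      hlaw p.1 (window_subset_Icc t k p.1.2) p.2
    have hEint : ∀ (g : Z → ℝ), Measurable g → ∀ p : (Σ j : window t k, Fin (B j)),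
        ∫ ω, g (z p.1 p.2 ω) ∂μ = ∫ x, g x ∂(P p.1) := fun g hg p =>
      (hlaw' p).integral_comp hg.aestronglyMeasurable
    have hmbar : meanGap ℓ P B f₁ f₂ t k = n⁻¹ * ∑ p : (Σ j : window t k, Fin (B j)),
        ∫ ω, lossDiff ℓ f₁ f₂ (fun j i => z j i ω) p.1 p.2 ∂μ := by
      have : ∀ p : (Σ j : window t k, Fin (B j)),
          ∫ ω, lossDiff ℓ f₁ f₂ (fun j i => z j i ω) p.1 p.2 ∂μ = gap ℓ P f₁ f₂ p.1 := fun p =>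
        (hEint _ hdm p).trans (hgap _)
      simp_rw [this]
      rw [sum_window_sigma fun j _ => gap ℓ P f₁ f₂ j]
      simp [meanGap, hn]
    have hs2 : n⁻¹ * ∑ j ∈ window t k, (B j : ℝ) *
          ∫ x, (ℓ f₁ x - ℓ f₂ x - meanGap ℓ P B f₁ f₂ t k) ^ 2 ∂(P j)
        = n⁻¹ * ∑ p : (Σ j : window t k, Fin (B j)),
          ∫ ω, (lossDiff ℓ f₁ f₂ (fun j i => z j i ω) p.1 p.2
            - meanGap ℓ P B f₁ f₂ t k) ^ 2 ∂μ := by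
      have : ∀ p : (Σ j : window t k, Fin (B j)),
          ∫ ω, (lossDiff ℓ f₁ f₂ (fun j i => z j i ω) p.1 p.2
            - meanGap ℓ P B f₁ f₂ t k) ^ 2 ∂μ
          = ∫ x, (ℓ f₁ x - ℓ f₂ x - meanGap ℓ P B f₁ f₂ t k) ^ 2 ∂(P p.1) := fun p =>
        hEint _ ((hdm.sub_const _).pow_const 2) p
      simp_rw [this]
      rw [sum_window_sigma fun j _ =>
        ∫ x, (ℓ f₁ x - ℓ f₂ x - meanGap ℓ P B f₁ f₂ t k) ^ 2 ∂(P j)]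
      simp
    have hs20 : 0 ≤ n⁻¹ * ∑ j ∈ window t k, (B j : ℝ) *
        ∫ x, (ℓ f₁ x - ℓ f₂ x - meanGap ℓ P B f₁ f₂ t k) ^ 2 ∂(P j) :=
      mul_nonneg (by positivity) (Finset.sum_nonneg fun j _ =>
        mul_nonneg (Nat.cast_nonneg _) (integral_nonneg fun x => sq_nonneg _))
    have hmain := empirical_bernstein hindu
      (fun p => hdm.comp_aemeasurable (hlaw' p).aemeasurable) (lo := a - b) (M := 2 * (b - a))
      (L := L) (by linarith) (by linarith) (fun p ω => hdmem _) card_window_sigma hn2 hmbar hs2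
      (ubar := fun ω => muHat (lossDiff ℓ f₁ f₂ fun j i => z j i ω) t k)
      (v := fun ω => vHat (lossDiff ℓ f₁ f₂ fun j i => z j i ω) t k)
      (fun ω => by rw [muHat, ← sum_window_sigma])
      (fun ω => by
        rw [vHat, ← sum_window_sigma fun j i => (lossDiff ℓ f₁ f₂ (fun j i => z j i ω) j i
          - muHat (lossDiff ℓ f₁ f₂ fun j i => z j i ω) t k) ^ 2])
    refine le_trans (measureReal_mono ?_) hmain
    intro ω hω hgood
    refine hω ?_
    obtain ⟨h1, h2⟩ := hgood
    rw [psiHat, if_neg hone]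
    refine ⟨h1, ?_⟩
    rw [oracleBound_eq]
    exact variance_proxy_le hn2 hL (by linarith) sigmaTilde_nonneg maxDrift_nonneg
      (average_sq_le hpos hmem hgap) hs20 h2

end Comparison

end RollingWindow

/-! ### From estimation error to excess risk, and the union bound -/

namespace RollingWindow

variable {F Z : Type*} [MeasurableSpace Z] {ℓ : F → Z → ℝ} {f₁ f₂ : F} {P : ℕ → Measure Z}
  {B : ℕ → ℕ} {t : ℕ}

/-- The comparison has small excess risk whenever every window average is within `ψ̂` of its mean
and every `ψ̂` is of the order of the oracle bound. -/
lemma excess_risk_le_of_good (hB : ∀ j ∈ Finset.Icc 1 t, 1 ≤ B j)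
    {z : (j : ℕ) → Fin (B j) → Z} {M δ L r : ℝ} (hL : 1 ≤ L)
    (hgood : ∀ k ∈ Finset.Icc 1 t,
      |muHat (lossDiff ℓ f₁ f₂ z) t k - meanGap ℓ P B f₁ f₂ t k|
          ≤ psiHat (lossDiff ℓ f₁ f₂ z) M δ t k ∧
        psiHat (lossDiff ℓ f₁ f₂ z) M δ t k ≤ 15 * max 1 r * L * oracleBound ℓ P B f₁ f₂ t k)
    {fhat : F} (hout : IsCompareOutput ℓ f₁ f₂ z M δ t fhat) {k : ℕ} (hk : k ∈ Finset.Icc 1 t) :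
    risk ℓ (P t) fhat - min (risk ℓ (P t) f₁) (risk ℓ (P t) f₂)
      ≤ 50 * max 1 r * L * oracleBound ℓ P B f₁ f₂ t k := by
  obtain ⟨khat, hsel, hcase⟩ := hout
  have herr := abs_muHat_selected_sub_le hk hsel (fun i hi => (hgood i hi).1)
    (θ := gap ℓ P f₁ f₂ t) (β := maxDrift ℓ P f₁ f₂ t k) (fun i hi => by
      rw [Finset.mem_Icc] at hi hk
      exact abs_meanGap_sub_le
        (windowSize_pos hB (Finset.mem_Icc.mpr ⟨hi.1, hi.2.trans hk.2⟩)) hi.2)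
  have hdrift : maxDrift ℓ P f₁ f₂ t k ≤ max 1 r * L * oracleBound ℓ P B f₁ f₂ t k := by
    refine maxDrift_le_oracleBound.trans (le_mul_of_one_le_left oracleBound_nonneg ?_)
    exact one_le_mul_of_one_le_of_one_le (le_max_left _ _) hL
  have hpsi := (hgood k hk).2
  -- The constant is `50 = 5 + 3 · 15`: five drifts and three variance proxies.
  have hfin : |muHat (lossDiff ℓ f₁ f₂ z) t khat - gap ℓ P f₁ f₂ t|
      ≤ 50 * max 1 r * L * oracleBound ℓ P B f₁ f₂ t k := by linarith
  have habs := abs_le.mp hfin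
  have h0 : 0 ≤ 50 * max 1 r * L * oracleBound ℓ P B f₁ f₂ t k := (abs_nonneg _).trans hfin
  have hgap : gap ℓ P f₁ f₂ t = risk ℓ (P t) f₁ - risk ℓ (P t) f₂ := rfl
  rw [hgap] at habs
  rcases hcase with ⟨hmu, rfl⟩ | ⟨hmu, rfl⟩
  · rcases min_choice (risk ℓ (P t) fhat) (risk ℓ (P t) f₂) with h | h <;> rw [h] <;>
      linarith [habs.1, habs.2]
  · rcases min_choice (risk ℓ (P t) f₁) (risk ℓ (P t) fhat) with h | h <;> rw [h] <;>
      linarith [habs.1, habs.2]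

end RollingWindow

theorem mainTheorem2 :
    ∃ C : ℝ, 0 < C ∧
      ∀ (F : Type*) (Z : Type*) [MeasurableSpace Z] (ℓ : F → Z → ℝ) (a b : ℝ)
        (_ : ∀ f, Measurable (ℓ f)) (_ : ∀ f z, ℓ f z ∈ Set.Icc a b)
        (f₁ f₂ : F) (t : ℕ) (_ : 1 ≤ t)
        (P : ℕ → Measure Z) [∀ j, IsProbabilityMeasure (P j)]
        (B : ℕ → ℕ) (_ : ∀ j ∈ Finset.Icc 1 t, 1 ≤ B j)
        (Ω : Type*) [MeasurableSpace Ω] (μ : Measure Ω) [IsProbabilityMeasure μ]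
        (z : (j : ℕ) → Fin (B j) → Ω → Z)
        (_ : ∀ j ∈ Finset.Icc 1 t, ∀ i, HasLaw (z j i) (P j) μ)
        (_ : iIndepFun (fun p : (Σ j : Finset.Icc 1 t, Fin (B j)) => z p.1 p.2) μ)
        (δ : ℝ) (_ : δ ∈ Set.Ioo (0 : ℝ) 1),
        1 - δ ≤ μ.real {ω | ∀ fhat : F,
          RollingWindow.IsCompareOutput ℓ f₁ f₂ (fun j i => z j i ω)
              (2 * (b - a)) (δ / (3 * t)) t fhat →
            RollingWindow.risk ℓ (P t) fhat
                - min (RollingWindow.risk ℓ (P t) f₁) (RollingWindow.risk ℓ (P t) f₂)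
              ≤ C * max 1 (b - a) * Real.log (6 * t / δ) *
                ⨅ k : Finset.Icc 1 t, RollingWindow.oracleBound ℓ P B f₁ f₂ t k} := by
  refine ⟨50, by norm_num, ?_⟩
  intro F Z _ ℓ a b hℓm hℓ f₁ f₂ t ht P _ B hB Ω _ μ _ z hlaw hind δ hδ
  obtain ⟨hδ0, hδ1⟩ := hδ
  have ht1 : (1 : ℝ) ≤ t := by exact_mod_cast ht
  have hlog : 2 / (δ / (3 * t)) = 6 * t / δ := by field_simp; ring
  -- `6t/δ > 6 > e`.
  have hL : 1 ≤ Real.log (6 * t / δ) := by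
    rw [Real.le_log_iff_exp_le (by positivity), le_div_iff₀ hδ0]
    have := Real.exp_one_lt_d9
    nlinarith
  have : Nonempty (Finset.Icc 1 t) := ⟨⟨1, Finset.mem_Icc.mpr ⟨le_rfl, ht⟩⟩⟩
  obtain ⟨k₀, hk₀⟩ := exists_eq_ciInf_of_finite
    (f := fun k : Finset.Icc 1 t => RollingWindow.oracleBound ℓ P B f₁ f₂ t k)
  rw [← hk₀]
  obtain ⟨x⟩ : Nonempty Z := nonempty_of_isProbabilityMeasure (P t)
  have hab : a ≤ b := (hℓ f₁ x).1.trans (hℓ f₁ x).2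
  -- For `a = b` the losses are constant and the excess risk is zero; the concentration argument
  -- needs `M > 0`.
  rcases hab.eq_or_lt with rfl | hab
  · have hrisk : ∀ f, RollingWindow.risk ℓ (P t) f = a := fun f => by
      have : ∀ x, ℓ f x = a := fun x => le_antisymm (hℓ f x).2 (hℓ f x).1
      simp [RollingWindow.risk, this]
    have h0 : 0 ≤ 50 * max 1 (a - a) * Real.log (6 * t / δ) *
        RollingWindow.oracleBound ℓ P B f₁ f₂ t k₀ :=
      mul_nonneg (by positivity) RollingWindow.oracleBound_nonneg
    simp only [hrisk, min_self, sub_self] at h0 ⊢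
    simp only [h0, implies_true, Set.ofPred_true, probReal_univ]
    linarith
  · set bad : ℕ → Set Ω := fun k => {ω |
      ¬ (|RollingWindow.muHat (RollingWindow.lossDiff ℓ f₁ f₂ fun j i => z j i ω) t k
            - RollingWindow.meanGap ℓ P B f₁ f₂ t k|
          ≤ RollingWindow.psiHat (RollingWindow.lossDiff ℓ f₁ f₂ fun j i => z j i ω)
            (2 * (b - a)) (δ / (3 * t)) t k ∧
        RollingWindow.psiHat (RollingWindow.lossDiff ℓ f₁ f₂ fun j i => z j i ω)
            (2 * (b - a)) (δ / (3 * t)) t k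
          ≤ 15 * max 1 (b - a) * Real.log (2 / (δ / (3 * t))) *
            RollingWindow.oracleBound ℓ P B f₁ f₂ t k)} with hbad_def
    -- `4 exp(-log(6t/δ)) = 4δ/(6t)`.
    have hbad : ∀ k ∈ Finset.Icc 1 t, μ.real (bad k) ≤ 2 * δ / (3 * t) := fun k hk => by
      have h := RollingWindow.measureReal_window_bad_le (f₁ := f₁) (f₂ := f₂) hℓm hℓ hab hB hlaw
        hind hk (δ := δ / (3 * t)) (by rwa [hlog])
      refine h.trans_eq ?_
      rw [hlog, Real.exp_neg, Real.exp_log (by positivity)]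
      field_simp
      ring
    have hunion : μ.real (⋃ k ∈ Finset.Icc 1 t, bad k) ≤ δ := by
      refine (measureReal_biUnion_finset_le _ _).trans ((Finset.sum_le_sum hbad).trans ?_)
      rw [Finset.sum_const, Nat.card_Icc, Nat.add_sub_cancel, nsmul_eq_mul]
      have : (t : ℝ) * (2 * δ / (3 * t)) = 2 / 3 * δ := by field_simp
      linarith
    -- Covering the whole space and using subadditivity avoids any measurability requirement on the
    -- good event, which quantifies over all of `F`.
    have hcover : (Set.univ : Set Ω) ⊆ {ω | ∀ fhat : F,
          RollingWindow.IsCompareOutput ℓ f₁ f₂ (fun j i => z j i ω)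
              (2 * (b - a)) (δ / (3 * t)) t fhat →
            RollingWindow.risk ℓ (P t) fhat
                - min (RollingWindow.risk ℓ (P t) f₁) (RollingWindow.risk ℓ (P t) f₂)
              ≤ 50 * max 1 (b - a) * Real.log (6 * t / δ) *
                RollingWindow.oracleBound ℓ P B f₁ f₂ t k₀} ∪ ⋃ k ∈ Finset.Icc 1 t, bad k := by
      intro ω _
      by_cases hω : ω ∈ ⋃ k ∈ Finset.Icc 1 t, bad k
      · exact Or.inr hω
      · refine Or.inl fun fhat hout => ?_
        refine RollingWindow.excess_risk_le_of_good hB hL (fun k hk => ?_) hout k₀.2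
        by_contra hcon
        refine hω (Set.mem_biUnion hk ?_)
        rw [← hlog] at hcon
        exact hcon
    have h1 := (measureReal_mono (μ := μ) hcover).trans (measureReal_union_le _ _)
    rw [probReal_univ] at h1
    linarith
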